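/- For $k<1$ let $$K(k)=\int_0^{\pi/2}\frac{d\theta}{\sqrt{1-k\sin^2\theta}},\qquad E(k)=\int_0^{\pi/2}\sqrt{1-k\sin^2\theta}\,d\theta$$ be the complete elliptic integrals of the first and second kind, as functions of the parameter $k$ (the square of the modulus), and for $0<k<1$ put $r(k)=K(1-k)/K(k)$. For every real $r>0$ there is exactly one $k_r\in(0,1)$ with $r(k_r)=r$. The function $r(k)$ is differentiable at $k_r$; write $\{r,k\}=\frac{dr}{dk}\big|_{k=k_r}$. Then $$\{r,k\}=-\frac{\pi}{4k_r(1-k_r)K(k_r)^2}\neq 0,$$ and, with $q=e^{-\pi r}$, the series below converges and $$24\sum_{n=1}^{\infty}\frac{nq^n}{1-q^n}=1+\frac{6E(k_r)+(k_r-5)K(k_r)}{\pi k_r(1-k_r)K(k_r)\{r,k\}}.$$ -/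

import Mathlib

/-- The complete elliptic integral of the first kind as a function of the parameter `k`
(the square of the modulus): `K(k) = ∫_0^{π/2} dθ / √(1 - k sin² θ)`. -/
noncomputable def ellipticK (k : ℝ) : ℝ :=
  ∫ θ in (0 : ℝ)..(Real.pi / 2), 1 / Real.sqrt (1 - k * Real.sin θ ^ 2)

/-- The complete elliptic integral of the second kind as a function of the parameter `k`:
`E(k) = ∫_0^{π/2} √(1 - k sin² θ) dθ`. -/
noncomputable def ellipticE (k : ℝ) : ℝ :=
  ∫ θ in (0 : ℝ)..(Real.pi / 2), Real.sqrt (1 - k * Real.sin θ ^ 2)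

/-- The period ratio `r(k) = K(1 - k) / K(k)`, for `0 < k < 1`. -/
noncomputable def periodRatio (k : ℝ) : ℝ :=
  ellipticK (1 - k) / ellipticK k

/-!
Landen's substitution leaves Gauss's integral `∫ dθ / √(a² cos² θ + b² sin² θ)` unchanged when
`(a, b)` is replaced by its arithmetic and geometric means. The duplication formulas for theta
constants say that `q ↦ q²` performs exactly this step on `(θ₃(q)², θ₄(q)²)`, and both squares tend
to `1` as `q → 0`; hence `K(k) = (π / 2) θ₃(q)²` for `k = 1 - θ₄(q)⁴ / θ₃(q)⁴`. Poisson summation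
exchanges `k` and `1 - k` when `r` is replaced by `1 / r` in `q = e^(-πr)`, so `r(k) = r` for this
`k`. Legendre's relation evaluates the Wronskian of `K(k)` and `K(1 - k)`; this gives `dr/dk`, whose
sign makes `k` unique.

By the Jacobi triple product the theta constants are quotients of Euler products, and therefore
`q ∏ (1 - qⁿ)²⁴ = (2 K(k) / π)¹² k (1 - k)⁴ / 16`. The Lambert series `S` enters through
`q d/dq log (q ∏ (1 - qⁿ)²⁴) = 1 - 24 S`, and differentiating the logarithm of the right side in `k`
gives the formula.
-/

open Real Set Filter Topology MeasureTheory intervalIntegral Asymptotics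

/-! ### Gauss's integral and the arithmetic-geometric mean -/

/-- The weighted mean of `x` and `y` with weights `cos² θ` and `sin² θ`, the quadratic form under
the square root in Gauss's elliptic integral. -/
noncomputable def trigMean (x y θ : ℝ) : ℝ := x * cos θ ^ 2 + y * sin θ ^ 2

lemma continuous_trigMean (x y : ℝ) : Continuous (trigMean x y) := by
  unfold trigMean
  fun_prop

lemma le_trigMean {m x y : ℝ} (hx : m ≤ x) (hy : m ≤ y) (θ : ℝ) : m ≤ trigMean x y θ :=
  calc m = m * cos θ ^ 2 + m * sin θ ^ 2 := by rw [← mul_add, cos_sq_add_sin_sq, mul_one]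
    _ ≤ trigMean x y θ := by unfold trigMean; gcongr

lemma trigMean_le {M x y : ℝ} (hx : x ≤ M) (hy : y ≤ M) (θ : ℝ) : trigMean x y θ ≤ M :=
  calc trigMean x y θ ≤ M * cos θ ^ 2 + M * sin θ ^ 2 := by unfold trigMean; gcongr
    _ = M := by rw [← mul_add, cos_sq_add_sin_sq, mul_one]

lemma trigMean_pos {x y : ℝ} (hx : 0 < x) (hy : 0 < y) (θ : ℝ) : 0 < trigMean x y θ :=
  (lt_min hx hy).trans_le (le_trigMean (min_le_left x y) (min_le_right x y) θ)

lemma trigMean_pi_sub (x y θ : ℝ) : trigMean x y (π - θ) = trigMean x y θ := by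
  simp only [trigMean, cos_pi_sub, sin_pi_sub, neg_sq]

/-- Gauss's form of the complete elliptic integral of the first kind,
`∫_0^{π/2} dθ / √(a² cos² θ + b² sin² θ)`. -/
noncomputable def gaussIntegral (a b : ℝ) : ℝ :=
  ∫ θ in (0 : ℝ)..(π / 2), 1 / √(trigMean (a ^ 2) (b ^ 2) θ)

lemma ellipticK_one_sub_sq_div_sq {a : ℝ} (ha : 0 < a) (b : ℝ) :
    ellipticK (1 - b ^ 2 / a ^ 2) = a * gaussIntegral a b := by
  rw [ellipticK, gaussIntegral, ← intervalIntegral.integral_const_mul]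
  refine integral_congr fun θ _ => ?_
  have factor_out : trigMean (a ^ 2) (b ^ 2) θ
      = a ^ 2 * (1 - (1 - b ^ 2 / a ^ 2) * sin θ ^ 2) := by
    rw [trigMean, cos_sq']
    field_simp
    ring
  simp only [factor_out, sqrt_mul (sq_nonneg a), sqrt_sq ha.le]
  field_simp

lemma ellipticK_eq_gaussIntegral {k : ℝ} (hk : k ≤ 1) :
    ellipticK k = gaussIntegral 1 √(1 - k) := by
  simpa [sq_sqrt (sub_nonneg.2 hk)] using ellipticK_one_sub_sq_div_sq one_pos √(1 - k)

section Gauss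

variable {a b : ℝ}

lemma sqrt_trigMean_sq_pos (ha : 0 < a) (hb : 0 < b) (θ : ℝ) :
    0 < √(trigMean (a ^ 2) (b ^ 2) θ) :=
  sqrt_pos.2 (trigMean_pos (pow_pos ha 2) (pow_pos hb 2) θ)

lemma continuous_one_div_sqrt_trigMean_sq (ha : 0 < a) (hb : 0 < b) :
    Continuous fun θ => 1 / √(trigMean (a ^ 2) (b ^ 2) θ) :=
  continuous_const.div (continuous_trigMean _ _).sqrt fun θ => (sqrt_trigMean_sq_pos ha hb θ).ne'

lemma gaussIntegral_le {m : ℝ} (hm : 0 < m) (ha : m ≤ a) (hb : m ≤ b) :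
    gaussIntegral a b ≤ π / 2 / m := by
  calc gaussIntegral a b ≤ ∫ _ in (0 : ℝ)..(π / 2), 1 / m := by
        refine integral_mono_on (by positivity) ((continuous_one_div_sqrt_trigMean_sq
          (hm.trans_le ha) (hm.trans_le hb)).intervalIntegrable _ _)
          intervalIntegrable_const fun θ _ => ?_
        exact one_div_le_one_div_of_le hm
          (le_sqrt_of_sq_le (le_trigMean (by gcongr) (by gcongr) θ))
    _ = π / 2 / m := by simp [div_eq_mul_inv]

lemma le_gaussIntegral {M : ℝ} (ha : 0 < a) (hb : 0 < b) (haM : a ≤ M) (hbM : b ≤ M) :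
    π / 2 / M ≤ gaussIntegral a b := by
  calc π / 2 / M = ∫ _ in (0 : ℝ)..(π / 2), 1 / M := by simp [div_eq_mul_inv]
    _ ≤ gaussIntegral a b := by
        refine integral_mono_on (by positivity) intervalIntegrable_const
          ((continuous_one_div_sqrt_trigMean_sq ha hb).intervalIntegrable _ _) fun θ _ => ?_
        exact one_div_le_one_div_of_le (sqrt_trigMean_sq_pos ha hb θ)
          (sqrt_le_iff.2 ⟨ha.le.trans haM, trigMean_le (by gcongr) (by gcongr) θ⟩)

lemma tendsto_gaussIntegral {ι : Type*} {l : Filter ι} {u v : ι → ℝ} {c : ℝ} (hc : 0 < c)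
    (hu : Tendsto u l (𝓝 c)) (hv : Tendsto v l (𝓝 c)) :
    Tendsto (fun i => gaussIntegral (u i) (v i)) l (𝓝 (π / 2 / c)) := by
  have lower : Tendsto (fun i => π / 2 / max (u i) (v i)) l (𝓝 (π / 2 / c)) := by
    simpa [Pi.div_def] using
      (tendsto_const_nhds (x := π / 2)).div (hu.max hv) (by simpa using hc.ne')
  have upper : Tendsto (fun i => π / 2 / min (u i) (v i)) l (𝓝 (π / 2 / c)) := by
    simpa [Pi.div_def] using
      (tendsto_const_nhds (x := π / 2)).div (hu.min hv) (by simpa using hc.ne')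
  refine tendsto_of_tendsto_of_tendsto_of_le_of_le' lower upper ?_ ?_ <;>
    filter_upwards [hu.eventually_const_lt hc, hv.eventually_const_lt hc] with i hui hvi
  · exact le_gaussIntegral hui hvi (le_max_left _ _) (le_max_right _ _)
  · exact gaussIntegral_le (lt_min hui hvi) (min_le_left _ _) (min_le_right _ _)

lemma integral_zero_pi_one_div_sqrt_trigMean_sq (ha : 0 < a) (hb : 0 < b) :
    ∫ θ in (0 : ℝ)..π, 1 / √(trigMean (a ^ 2) (b ^ 2) θ) = 2 * gaussIntegral a b := by
  have hc := continuous_one_div_sqrt_trigMean_sq ha hb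
  have reflect : ∫ θ in (π / 2)..π, 1 / √(trigMean (a ^ 2) (b ^ 2) θ) = gaussIntegral a b := by
    have := integral_comp_sub_left (a := π / 2) (b := π)
      (fun θ => 1 / √(trigMean (a ^ 2) (b ^ 2) θ)) π
    simp only [trigMean_pi_sub, sub_self, sub_half] at this
    exact this
  rw [← integral_add_adjacent_intervals (hc.intervalIntegrable 0 (π / 2))
    (hc.intervalIntegrable (π / 2) π), reflect, two_mul, gaussIntegral]

/-- The tangent of `2φ - landenAngle a b φ`. -/
noncomputable def landenTan (a b φ : ℝ) : ℝ := (a - b) * (sin φ * cos φ) / trigMean a b φ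

/-- The amplitude in Landen's transformation, the solution of
`tan (landenAngle a b φ - φ) = (b / a) * tan φ` that is continuous in `φ` and vanishes at `0`. -/
noncomputable def landenAngle (a b φ : ℝ) : ℝ := 2 * φ - arctan (landenTan a b φ)

lemma landenAngle_zero (a b : ℝ) : landenAngle a b 0 = 0 := by
  simp [landenAngle, landenTan]

lemma landenAngle_pi_div_two (a b : ℝ) : landenAngle a b (π / 2) = π := by
  simp [landenAngle, landenTan, mul_div_cancel₀]

lemma one_add_landenTan_sq (ha : 0 < a) (hb : 0 < b) (φ : ℝ) :
    1 + landenTan a b φ ^ 2 = trigMean (a ^ 2) (b ^ 2) φ / trigMean a b φ ^ 2 := by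
  have hmean := (trigMean_pos ha hb φ).ne'
  rw [landenTan, div_pow, eq_div_iff (pow_ne_zero 2 hmean), add_mul,
    div_mul_cancel₀ _ (pow_ne_zero 2 hmean), mul_pow, mul_pow]
  simp only [trigMean, cos_sq']
  ring

lemma sqrt_one_add_landenTan_sq (ha : 0 < a) (hb : 0 < b) (φ : ℝ) :
    √(1 + landenTan a b φ ^ 2) = √(trigMean (a ^ 2) (b ^ 2) φ) / trigMean a b φ := by
  rw [one_add_landenTan_sq ha hb, sqrt_div' _ (sq_nonneg _), sqrt_sq (trigMean_pos ha hb φ).le]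

lemma hasDerivAt_landenTan (ha : 0 < a) (hb : 0 < b) (φ : ℝ) :
    HasDerivAt (landenTan a b)
      ((a - b) * (a * cos φ ^ 2 - b * sin φ ^ 2) / trigMean a b φ ^ 2) φ := by
  have hsin := hasDerivAt_sin φ
  have hcos := hasDerivAt_cos φ
  refine (((hsin.mul hcos).const_mul (a - b)).div
    (((hcos.pow 2).const_mul a).add ((hsin.pow 2).const_mul b))
    (trigMean_pos ha hb φ).ne').congr_deriv ?_
  simp only [trigMean, Pi.mul_apply, Pi.add_apply, Pi.pow_apply]
  congr 1
  have hcos4 : cos φ ^ 4 = (1 - sin φ ^ 2) ^ 2 := by rw [← cos_sq']; ring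
  ring_nf
  simp only [cos_sq', hcos4]
  ring

lemma hasDerivAt_landenAngle (ha : 0 < a) (hb : 0 < b) (φ : ℝ) :
    HasDerivAt (landenAngle a b)
      ((a + b) * trigMean a b φ / trigMean (a ^ 2) (b ^ 2) φ) φ := by
  refine (((hasDerivAt_id φ).const_mul 2).sub
    (hasDerivAt_landenTan ha hb φ).arctan).congr_deriv ?_
  have hmean := (trigMean_pos ha hb φ).ne'
  have hmean_sq := (trigMean_pos (pow_pos ha 2) (pow_pos hb 2) φ).ne'
  rw [one_add_landenTan_sq ha hb, eq_div_iff hmean_sq]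
  field_simp
  simp only [trigMean, cos_sq']
  ring

lemma cos_landenAngle (ha : 0 < a) (hb : 0 < b) (φ : ℝ) :
    cos (landenAngle a b φ)
      = (a * cos φ ^ 2 - b * sin φ ^ 2) / √(trigMean (a ^ 2) (b ^ 2) φ) := by
  have hmean := (trigMean_pos ha hb φ).ne'
  have hsqrt := (sqrt_trigMean_sq_pos ha hb φ).ne'
  rw [landenAngle, cos_sub, cos_arctan, sin_arctan, sqrt_one_add_landenTan_sq ha hb, landenTan,
    sin_two_mul, cos_two_mul]
  field_simp
  simp only [trigMean]
  linear_combination (2 * a * cos φ ^ 2) * cos_sq' φ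

lemma sin_landenAngle (ha : 0 < a) (hb : 0 < b) (φ : ℝ) :
    sin (landenAngle a b φ) = (a + b) * (sin φ * cos φ) / √(trigMean (a ^ 2) (b ^ 2) φ) := by
  have hmean := (trigMean_pos ha hb φ).ne'
  have hsqrt := (sqrt_trigMean_sq_pos ha hb φ).ne'
  rw [landenAngle, sin_sub, cos_arctan, sin_arctan, sqrt_one_add_landenTan_sq ha hb, landenTan,
    sin_two_mul, cos_two_mul]
  field_simp
  simp only [trigMean]
  linear_combination (2 * b * sin φ * cos φ) * cos_sq' φ

lemma trigMean_landenAngle (ha : 0 < a) (hb : 0 < b) (φ : ℝ) :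
    trigMean (((a + b) / 2) ^ 2) (a * b) (landenAngle a b φ)
      = ((a + b) / 2 * trigMean a b φ) ^ 2 / trigMean (a ^ 2) (b ^ 2) φ := by
  rw [trigMean, cos_landenAngle ha hb, sin_landenAngle ha hb, div_pow (_ - _),
    div_pow (_ * (_ * _)), sq_sqrt (trigMean_pos (pow_pos ha 2) (pow_pos hb 2) φ).le,
    mul_div_assoc', mul_div_assoc', ← add_div]
  congr 1
  simp only [trigMean]
  ring

theorem gaussIntegral_add_div_two {g : ℝ} (ha : 0 < a) (hb : 0 < b) (hg : 0 < g)
    (hgab : g ^ 2 = a * b) : gaussIntegral ((a + b) / 2) g = gaussIntegral a b := by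
  have hmid : 0 < (a + b) / 2 := by positivity
  have hmean_sq := trigMean_pos (pow_pos ha 2) (pow_pos hb 2)
  have landen_substitution := integral_comp_mul_deriv (a := 0) (b := π / 2)
    (fun φ _ => hasDerivAt_landenAngle ha hb φ)
    (((continuous_trigMean a b).const_mul (a + b)).div (continuous_trigMean _ _)
      fun φ => (hmean_sq φ).ne').continuousOn
    (continuous_one_div_sqrt_trigMean_sq hmid hg)
  rw [landenAngle_zero, landenAngle_pi_div_two,
    integral_zero_pi_one_div_sqrt_trigMean_sq hmid hg] at landen_substitution
  suffices 2 * gaussIntegral ((a + b) / 2) g = 2 * gaussIntegral a b by linarith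
  rw [← landen_substitution, gaussIntegral, ← intervalIntegral.integral_const_mul]
  refine integral_congr fun φ _ => ?_
  have hmean := trigMean_pos ha hb φ
  have hsqrt := sqrt_trigMean_sq_pos ha hb φ
  simp only [Function.comp_apply, hgab]
  rw [trigMean_landenAngle ha hb, sqrt_div (sq_nonneg _), sqrt_sq (by positivity)]
  nth_rw 2 [← sq_sqrt (hmean_sq φ).le]
  field_simp

end Gauss

/-! ### The derivatives of the complete elliptic integrals -/

theorem hasDerivAt_integral_of_continuousOn_deriv {E : Type*} [NormedAddCommGroup E]
    [NormedSpace ℝ E] {F F' : ℝ → ℝ → E} {U : Set ℝ} {a b x₀ : ℝ} (hU : U ∈ 𝓝 x₀)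
    (hF : ∀ x ∈ U, ContinuousOn (F x) (uIcc a b))
    (hF' : ContinuousOn (Function.uncurry F') (U ×ˢ uIcc a b))
    (hderiv : ∀ x ∈ U, ∀ t ∈ uIcc a b, HasDerivAt (F · t) (F' x t) x) :
    HasDerivAt (fun x => ∫ t in a..b, F x t) (∫ t in a..b, F' x₀ t) x₀ := by
  obtain ⟨ε, hε, hball⟩ := Metric.nhds_basis_closedBall.mem_iff.1 hU
  have hx₀ : x₀ ∈ U := mem_of_mem_nhds hU
  have hF'₀ : ContinuousOn (F' x₀) (uIcc a b) := hF'.uncurry_left x₀ hx₀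
  obtain ⟨C, hC⟩ := ((isCompact_closedBall x₀ ε).prod isCompact_uIcc).exists_bound_of_continuousOn
    (hF'.mono (prod_mono_left hball))
  refine (hasDerivAt_integral_of_dominated_loc_of_deriv_le (μ := volume) (bound := fun _ => C)
    (Metric.closedBall_mem_nhds x₀ hε) ?_ (hF x₀ hx₀).intervalIntegrable ?_ ?_
    intervalIntegrable_const ?_).2
  · filter_upwards [hU] with x hx
    exact ((hF x hx).mono uIoc_subset_uIcc).aestronglyMeasurable measurableSet_uIoc
  · exact (hF'₀.mono uIoc_subset_uIcc).aestronglyMeasurable measurableSet_uIoc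
  · exact .of_forall fun t ht x hx => hC (x, t) ⟨hx, uIoc_subset_uIcc ht⟩
  · exact .of_forall fun t ht x hx => hderiv x (hball hx) t (uIoc_subset_uIcc ht)

/-- Legendre's `Δ(θ) = √(1 - k sin² θ)`. -/
noncomputable def legendreDelta (k θ : ℝ) : ℝ := √(1 - k * sin θ ^ 2)

lemma ellipticK_eq_integral_legendreDelta (k : ℝ) :
    ellipticK k = ∫ θ in (0 : ℝ)..(π / 2), 1 / legendreDelta k θ := rfl

lemma ellipticE_eq_integral_legendreDelta (k : ℝ) :
    ellipticE k = ∫ θ in (0 : ℝ)..(π / 2), legendreDelta k θ := rfl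

lemma continuous_uncurry_legendreDelta : Continuous (Function.uncurry legendreDelta) := by
  unfold legendreDelta
  fun_prop

lemma continuous_legendreDelta (k : ℝ) : Continuous (legendreDelta k) :=
  continuous_uncurry_legendreDelta.uncurry_left k

section LegendreDelta

variable {k : ℝ}

lemma one_sub_mul_sin_sq_pos (hk : k < 1) (θ : ℝ) : 0 < 1 - k * sin θ ^ 2 := by
  have := trigMean_pos one_pos (sub_pos.2 hk) θ
  rw [trigMean, cos_sq'] at this
  linarith

lemma legendreDelta_pos (hk : k < 1) (θ : ℝ) : 0 < legendreDelta k θ :=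
  sqrt_pos.2 (one_sub_mul_sin_sq_pos hk θ)

lemma legendreDelta_sq (hk : k < 1) (θ : ℝ) : legendreDelta k θ ^ 2 = 1 - k * sin θ ^ 2 :=
  sq_sqrt (one_sub_mul_sin_sq_pos hk θ).le

lemma continuous_one_div_legendreDelta_pow (hk : k < 1) (n : ℕ) :
    Continuous fun θ => 1 / legendreDelta k θ ^ n :=
  continuous_const.div ((continuous_legendreDelta k).pow n)
    fun θ => (pow_pos (legendreDelta_pos hk θ) n).ne'

lemma continuous_one_div_legendreDelta (hk : k < 1) :
    Continuous fun θ => 1 / legendreDelta k θ := by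
  simpa using continuous_one_div_legendreDelta_pow hk 1

lemma hasDerivAt_legendreDelta_param (hk : k < 1) (θ : ℝ) :
    HasDerivAt (legendreDelta · θ) (-(sin θ ^ 2) / (2 * legendreDelta k θ)) k := by
  have : HasDerivAt (fun k : ℝ => 1 - k * sin θ ^ 2) (-(sin θ ^ 2)) k := by
    simpa using ((hasDerivAt_id k).mul_const (sin θ ^ 2)).const_sub 1
  exact this.sqrt (one_sub_mul_sin_sq_pos hk θ).ne'

lemma hasDerivAt_one_div_legendreDelta_param (hk : k < 1) (θ : ℝ) :
    HasDerivAt (fun k => 1 / legendreDelta k θ) (sin θ ^ 2 / (2 * legendreDelta k θ ^ 3)) k := by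
  have hΔ := (legendreDelta_pos hk θ).ne'
  simp only [one_div]
  refine ((hasDerivAt_legendreDelta_param hk θ).inv hΔ).congr_deriv ?_
  field_simp

lemma hasDerivAt_legendreDelta (hk : k < 1) (θ : ℝ) :
    HasDerivAt (legendreDelta k) (-(k * (sin θ * cos θ)) / legendreDelta k θ) θ := by
  have : HasDerivAt (fun θ : ℝ => 1 - k * sin θ ^ 2) (-(k * (2 * sin θ * cos θ))) θ := by
    simpa using (((hasDerivAt_sin θ).pow 2).const_mul k).const_sub 1
  refine (this.sqrt (one_sub_mul_sin_sq_pos hk θ).ne').congr_deriv ?_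
  rw [legendreDelta]
  ring

lemma hasDerivAt_sin_mul_cos_div_legendreDelta (hk : k < 1) (θ : ℝ) :
    HasDerivAt (fun θ => k * (sin θ * cos θ / legendreDelta k θ))
      (legendreDelta k θ - (1 - k) * (1 / legendreDelta k θ ^ 3)) θ := by
  have hΔ := (legendreDelta_pos hk θ).ne'
  have hsq := legendreDelta_sq hk θ
  refine ((((hasDerivAt_sin θ).mul (hasDerivAt_cos θ)).div
    (hasDerivAt_legendreDelta hk θ) hΔ).const_mul k).congr_deriv ?_
  simp only [Pi.mul_apply]
  field_simp
  linear_combination (k * legendreDelta k θ ^ 2 + k ^ 2 * sin θ ^ 2) * cos_sq' θ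
    + (k * (1 - 2 * sin θ ^ 2) - legendreDelta k θ ^ 2 - (1 - k * sin θ ^ 2)) * hsq

lemma integral_one_div_legendreDelta_cube (hk : k < 1) :
    (1 - k) * ∫ θ in (0 : ℝ)..(π / 2), 1 / legendreDelta k θ ^ 3 = ellipticE k := by
  have hcube := (continuous_one_div_legendreDelta_pow hk 3).const_mul (1 - k)
  have hΔ := continuous_legendreDelta k
  have ftc := integral_eq_sub_of_hasDerivAt (a := 0) (b := π / 2)
    (fun θ _ => hasDerivAt_sin_mul_cos_div_legendreDelta hk θ)
    ((hΔ.sub hcube).intervalIntegrable _ _)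
  rw [integral_sub (hΔ.intervalIntegrable _ _) (hcube.intervalIntegrable _ _),
    intervalIntegral.integral_const_mul] at ftc
  simp only [cos_pi_div_two, sin_zero, mul_zero, zero_mul, zero_div, sub_zero] at ftc
  exact (sub_eq_zero.1 ftc).symm

lemma hasDerivAt_ellipticE_integral (hk : k < 1) :
    HasDerivAt ellipticE
      (∫ θ in (0 : ℝ)..(π / 2), -(sin θ ^ 2) / (2 * legendreDelta k θ)) k := by
  refine hasDerivAt_integral_of_continuousOn_deriv (Iio_mem_nhds hk)
    (fun k _ => (continuous_legendreDelta k).continuousOn) ?_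
    fun k hk θ _ => hasDerivAt_legendreDelta_param hk θ
  refine .div (by fun_prop) (continuous_uncurry_legendreDelta.const_mul 2).continuousOn
    fun p hp => ?_
  exact (mul_pos two_pos (legendreDelta_pos hp.1 p.2)).ne'

lemma hasDerivAt_ellipticK_integral (hk : k < 1) :
    HasDerivAt ellipticK
      (∫ θ in (0 : ℝ)..(π / 2), sin θ ^ 2 / (2 * legendreDelta k θ ^ 3)) k := by
  refine hasDerivAt_integral_of_continuousOn_deriv (Iio_mem_nhds hk)
    (fun k hk => (continuous_one_div_legendreDelta hk).continuousOn) ?_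
    fun k hk θ _ => hasDerivAt_one_div_legendreDelta_param hk θ
  refine .div (by fun_prop) ((continuous_uncurry_legendreDelta.pow 3).const_mul 2).continuousOn
    fun p hp => ?_
  exact (mul_pos two_pos (pow_pos (legendreDelta_pos hp.1 p.2) 3)).ne'

lemma hasDerivAt_ellipticE (hk : k < 1) (hk₀ : k ≠ 0) :
    HasDerivAt ellipticE ((ellipticE k - ellipticK k) / (2 * k)) k := by
  refine (hasDerivAt_ellipticE_integral hk).congr_deriv ?_
  rw [ellipticE_eq_integral_legendreDelta, ellipticK_eq_integral_legendreDelta,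
    ← integral_sub ((continuous_legendreDelta k).intervalIntegrable _ _)
    ((continuous_one_div_legendreDelta hk).intervalIntegrable _ _), ← intervalIntegral.integral_div]
  refine integral_congr fun θ _ => ?_
  have hΔ := (legendreDelta_pos hk θ).ne'
  field_simp
  rw [legendreDelta_sq hk]
  ring

lemma hasDerivAt_ellipticK (hk : k < 1) (hk₀ : k ≠ 0) :
    HasDerivAt ellipticK ((ellipticE k - (1 - k) * ellipticK k) / (2 * k * (1 - k))) k := by
  refine (hasDerivAt_ellipticK_integral hk).congr_deriv ?_
  rw [← integral_one_div_legendreDelta_cube hk, ← mul_sub, mul_comm (2 * k),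
    mul_div_mul_left _ _ (sub_pos.2 hk).ne', ellipticK_eq_integral_legendreDelta,
    ← integral_sub ((continuous_one_div_legendreDelta_pow hk 3).intervalIntegrable _ _)
    ((continuous_one_div_legendreDelta hk).intervalIntegrable _ _), ← intervalIntegral.integral_div]
  refine integral_congr fun θ _ => ?_
  have hΔ := (legendreDelta_pos hk θ).ne'
  field_simp
  rw [legendreDelta_sq hk]
  ring

lemma ellipticK_pos (hk : k < 1) : 0 < ellipticK k :=
  intervalIntegral_pos_of_pos ((continuous_one_div_legendreDelta hk).intervalIntegrable _ _)
    (fun θ => one_div_pos.2 (legendreDelta_pos hk θ)) (by positivity)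

end LegendreDelta

/-! ### Legendre's relation and the period ratio -/

lemma ellipticK_zero : ellipticK 0 = π / 2 := by simp [ellipticK]

lemma ellipticE_zero : ellipticE 0 = π / 2 := by simp [ellipticE]

lemma ellipticE_one : ellipticE 1 = 1 := by
  calc ellipticE 1 = ∫ θ in (0 : ℝ)..(π / 2), cos θ := by
        refine integral_congr fun θ hθ => ?_
        rw [uIcc_of_le (by positivity)] at hθ
        simp only [one_mul]
        rw [← cos_sq', sqrt_sq (cos_nonneg_of_mem_Icc ⟨by linarith [hθ.1, pi_pos], hθ.2⟩)]
    _ = 1 := by simp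

lemma continuous_ellipticE : Continuous ellipticE :=
  continuous_parametric_intervalIntegral_of_continuous' (μ := volume)
    continuous_uncurry_legendreDelta 0 (π / 2)

lemma ellipticK_one_sub_le {k : ℝ} (hk : k ∈ Ioc (0 : ℝ) 1) :
    ellipticK (1 - k) ≤ π / 2 * (1 / √k) := by
  rw [ellipticK_eq_gaussIntegral (sub_le_self 1 hk.1.le), sub_sub_cancel, mul_one_div]
  exact gaussIntegral_le (sqrt_pos.2 hk.1) (sqrt_le_one.2 hk.2) le_rfl

/-- The left side of Legendre's relation. -/
noncomputable def legendreForm (k : ℝ) : ℝ :=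
  ellipticE k * ellipticK (1 - k) + ellipticE (1 - k) * ellipticK k
    - ellipticK k * ellipticK (1 - k)

lemma tendsto_ellipticK_sub_ellipticE_mul :
    Tendsto (fun k => (ellipticK k - ellipticE k) * ellipticK (1 - k)) (𝓝[>] 0) (𝓝 0) := by
  have difference_isBigO : (fun k => ellipticK k - ellipticE k) =O[𝓝[>] 0] fun k => k := by
    simpa [ellipticK_zero, ellipticE_zero] using
      ((hasDerivAt_ellipticK_integral zero_lt_one).sub
        (hasDerivAt_ellipticE_integral zero_lt_one)).isBigO_sub.mono nhdsWithin_le_nhds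
  have complement_isBigO : (fun k => ellipticK (1 - k)) =O[𝓝[>] 0] fun k => 1 / √k := by
    refine .of_bound (π / 2) ?_
    filter_upwards [Ioc_mem_nhdsGT one_pos] with k hk
    rw [norm_of_nonneg (ellipticK_pos (sub_lt_self 1 hk.1)).le, norm_of_nonneg (by positivity)]
    exact ellipticK_one_sub_le hk
  refine (difference_isBigO.mul complement_isBigO).trans_tendsto ?_
  simp only [mul_one_div, div_sqrt]
  simpa using (continuous_sqrt.tendsto 0).mono_left nhdsWithin_le_nhds

lemma tendsto_legendreForm_zero : Tendsto legendreForm (𝓝[>] 0) (𝓝 (π / 2)) := by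
  have hcont : ContinuousAt (fun k => ellipticE (1 - k) * ellipticK k) 0 :=
    (continuous_ellipticE.comp (continuous_const.sub continuous_id)).continuousAt.mul
      (hasDerivAt_ellipticK_integral zero_lt_one).continuousAt
  have hmain : Tendsto (fun k => ellipticE (1 - k) * ellipticK k) (𝓝[>] 0) (𝓝 (π / 2)) := by
    simpa [ellipticE_one, ellipticK_zero] using hcont.tendsto.mono_left nhdsWithin_le_nhds
  have := hmain.sub tendsto_ellipticK_sub_ellipticE_mul
  rw [sub_zero] at this
  refine this.congr fun k => ?_
  rw [legendreForm]
  ring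

section PeriodRatio

variable {k : ℝ}

lemma hasDerivAt_ellipticE_one_sub (hk : k ∈ Ioo (0 : ℝ) 1) :
    HasDerivAt (fun k => ellipticE (1 - k))
      ((ellipticK (1 - k) - ellipticE (1 - k)) / (2 * (1 - k))) k := by
  refine ((hasDerivAt_ellipticE (sub_lt_self 1 hk.1) (sub_pos.2 hk.2).ne').comp_const_sub
    1 k).congr_deriv ?_
  ring

lemma hasDerivAt_ellipticK_one_sub (hk : k ∈ Ioo (0 : ℝ) 1) :
    HasDerivAt (fun k => ellipticK (1 - k))
      ((k * ellipticK (1 - k) - ellipticE (1 - k)) / (2 * k * (1 - k))) k := by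
  refine ((hasDerivAt_ellipticK (sub_lt_self 1 hk.1) (sub_pos.2 hk.2).ne').comp_const_sub
    1 k).congr_deriv ?_
  rw [sub_sub_cancel]
  ring

lemma hasDerivAt_legendreForm (hk : k ∈ Ioo (0 : ℝ) 1) : HasDerivAt legendreForm 0 k := by
  have hk₀ := hk.1.ne'
  have hk₁ := (sub_pos.2 hk.2).ne'
  have dK := hasDerivAt_ellipticK hk.2 hk₀
  have dE := hasDerivAt_ellipticE hk.2 hk₀
  have dK' := hasDerivAt_ellipticK_one_sub hk
  have dE' := hasDerivAt_ellipticE_one_sub hk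
  refine (((dE.mul dK').add (dE'.mul dK)).sub (dK.mul dK')).congr_deriv ?_
  field_simp
  ring

theorem legendreForm_eq (hk : k ∈ Ioo (0 : ℝ) 1) : legendreForm k = π / 2 := by
  have hconst : ∀ x ∈ Ioo (0 : ℝ) 1, legendreForm x = legendreForm k := fun x hx =>
    isOpen_Ioo.is_const_of_deriv_eq_zero isPreconnected_Ioo
      (fun y hy => (hasDerivAt_legendreForm hy).differentiableAt.differentiableWithinAt)
      (fun y hy => (hasDerivAt_legendreForm hy).deriv) hx hk
  refine tendsto_nhds_unique (tendsto_const_nhds.congr' ?_) tendsto_legendreForm_zero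
  filter_upwards [Ioo_mem_nhdsGT one_pos] with x hx using (hconst x hx).symm

theorem hasDerivAt_periodRatio (hk : k ∈ Ioo (0 : ℝ) 1) :
    HasDerivAt periodRatio (-π / (4 * k * (1 - k) * ellipticK k ^ 2)) k := by
  have hk₀ := hk.1.ne'
  have hk₁ := (sub_pos.2 hk.2).ne'
  have hK := (ellipticK_pos hk.2).ne'
  refine ((hasDerivAt_ellipticK_one_sub hk).div
    (hasDerivAt_ellipticK hk.2 hk₀) hK).congr_deriv ?_
  have legendre := legendreForm_eq hk
  rw [legendreForm] at legendre
  field_simp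
  linear_combination (-4) * legendre

theorem deriv_periodRatio_neg (hk : k ∈ Ioo (0 : ℝ) 1) : deriv periodRatio k < 0 := by
  have hk₀ := hk.1
  have hk₁ := sub_pos.2 hk.2
  have hK := ellipticK_pos hk.2
  rw [(hasDerivAt_periodRatio hk).deriv]
  exact div_neg_of_neg_of_pos (neg_lt_zero.2 pi_pos) (by positivity)

theorem strictAntiOn_periodRatio : StrictAntiOn periodRatio (Ioo 0 1) :=
  strictAntiOn_of_deriv_neg (convex_Ioo 0 1)
    (fun _ hk => (hasDerivAt_periodRatio hk).continuousAt.continuousWithinAt)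
    fun _ hk => deriv_periodRatio_neg (interior_subset hk)

end PeriodRatio

/-! ### Gaussian binomial coefficients -/

section GaussBinom

/-- The finite Euler product `(q; q)_m = ∏_{1 ≤ j ≤ m} (1 - q ^ j)`. -/
def eulerProd {R : Type*} [CommRing R] (q : R) (m : ℕ) : R :=
  ∏ j ∈ Finset.range m, (1 - q ^ (j + 1))

/-- The Gaussian binomial coefficients, defined by the `q`-Pascal rule so that they make sense for
every `q`, in particular for roots of unity. -/
def gaussBinom {R : Type*} [CommSemiring R] (q : R) : ℕ → ℕ → R
  | _, 0 => 1
  | 0, _ + 1 => 0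
  | N + 1, i + 1 => gaussBinom q N (i + 1) + q ^ (N - i) * gaussBinom q N i

lemma gaussBinom_zero_right {R : Type*} [CommSemiring R] (q : R) (N : ℕ) :
    gaussBinom q N 0 = 1 := by
  cases N <;> rfl

lemma gaussBinom_succ_succ {R : Type*} [CommSemiring R] (q : R) (N i : ℕ) :
    gaussBinom q (N + 1) (i + 1) = gaussBinom q N (i + 1) + q ^ (N - i) * gaussBinom q N i := rfl

lemma gaussBinom_eq_zero_of_lt {R : Type*} [CommSemiring R] (q : R) {N i : ℕ} (h : N < i) :
    gaussBinom q N i = 0 := by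
  induction N generalizing i with
  | zero => obtain ⟨i, rfl⟩ := Nat.exists_eq_succ_of_ne_zero h.ne'; rfl
  | succ N ih =>
    obtain ⟨i, rfl⟩ := Nat.exists_eq_succ_of_ne_zero (Nat.ne_zero_of_lt h)
    rw [Nat.succ_eq_add_one, gaussBinom_succ_succ, ih (by omega), ih (by omega), mul_zero, add_zero]

lemma sum_gaussBinom_succ {R : Type*} [CommSemiring R] (q : R) (N : ℕ) (c : ℕ → R) :
    ∑ i ∈ Finset.range (N + 1), gaussBinom q N (i + 1) * c (i + 1) + c 0
      = ∑ i ∈ Finset.range (N + 1), gaussBinom q N i * c i := by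
  have := Finset.sum_range_succ' (fun i => gaussBinom q N i * c i) (N + 1)
  rw [gaussBinom_zero_right, one_mul] at this
  rw [← this, Finset.sum_range_succ _ (N + 1), gaussBinom_eq_zero_of_lt q N.lt_succ_self, zero_mul,
    add_zero]

theorem prod_one_add_mul_pow_eq_sum_gaussBinom {R : Type*} [CommSemiring R] (q x : R) (N : ℕ) :
    ∏ j ∈ Finset.range N, (1 + x * q ^ j)
      = ∑ i ∈ Finset.range (N + 1), gaussBinom q N i * (q ^ i.choose 2 * x ^ i) := by
  induction N with
  | zero => simp [gaussBinom_zero_right]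
  | succ N ih =>
    have second_pascal_term : ∀ i ∈ Finset.range (N + 1),
        q ^ (N - i) * gaussBinom q N i * (q ^ (i + 1).choose 2 * x ^ (i + 1))
          = gaussBinom q N i * (q ^ i.choose 2 * x ^ i) * (x * q ^ N) := fun i hi => by
      have hN : q ^ N = q ^ (N - i) * q ^ i := by
        rw [← pow_add, Nat.sub_add_cancel (Nat.lt_succ_iff.1 (Finset.mem_range.1 hi))]
      rw [hN, Nat.choose_succ_succ' i 1, Nat.choose_one_right]
      ring
    rw [Finset.prod_range_succ, ih, Finset.sum_range_succ' _ (N + 1)]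
    simp only [gaussBinom_succ_succ, add_mul, Finset.sum_add_distrib, mul_add, mul_one]
    rw [Finset.sum_congr rfl second_pascal_term, ← Finset.sum_mul,
      ← sum_gaussBinom_succ q N fun i => q ^ i.choose 2 * x ^ i, gaussBinom_zero_right, one_mul]
    ring

section CommRing

variable {R : Type*} [CommRing R] (q : R)

lemma eulerProd_succ (m : ℕ) : eulerProd q (m + 1) = eulerProd q m * (1 - q ^ (m + 1)) :=
  Finset.prod_range_succ _ m

lemma eulerProd_two_mul (m : ℕ) : eulerProd q (2 * m) =
    (∏ j ∈ Finset.range m, (1 - q ^ (2 * j + 1))) * eulerProd (q ^ 2) m := by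
  induction m with
  | zero => simp [eulerProd]
  | succ m ih =>
    rw [Nat.mul_succ, eulerProd_succ, eulerProd_succ, ih, Finset.prod_range_succ, eulerProd_succ]
    ring

lemma gaussBinom_mul_eulerProd_mul_eulerProd {N i : ℕ} (h : i ≤ N) :
    gaussBinom q N i * (eulerProd q i * eulerProd q (N - i)) = eulerProd q N := by
  induction N generalizing i with
  | zero =>
    obtain rfl : i = 0 := by omega
    simp [gaussBinom_zero_right, eulerProd]
  | succ N ih =>
    cases i with
    | zero => simp [gaussBinom_zero_right, eulerProd]
    | succ i =>
      have ih_left := ih (i := i) (by omega)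
      rw [gaussBinom_succ_succ, Nat.add_sub_add_right, eulerProd_succ q N]
      rcases Nat.eq_or_lt_of_le (show i ≤ N by omega) with rfl | hi
      · rw [gaussBinom_eq_zero_of_lt q i.lt_succ_self, eulerProd_succ]
        simp only [Nat.sub_self, pow_zero] at ih_left ⊢
        linear_combination (1 - q ^ (i + 1)) * ih_left
      · have ih_right := ih (i := i + 1) (by omega)
        obtain ⟨d, rfl⟩ := Nat.exists_eq_add_of_lt hi
        rw [show i + d + 1 - i = d + 1 by omega, eulerProd_succ q d] at ih_left ⊢
        rw [show i + d + 1 - (i + 1) = d by omega] at ih_right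
        rw [eulerProd_succ q i] at ih_right ⊢
        linear_combination (1 - q ^ (d + 1)) * ih_right
          + q ^ (d + 1) * (1 - q ^ (i + 1)) * ih_left

end CommRing

section Field

variable {K : Type*} [Field K] {q z : K}

/-- Up to a monomial, the finite triple product is the product in the `q`-binomial theorem with
base `q²` and `x = z q^(1 - 2m)`. -/
lemma prod_range_two_mul_one_add (hq : q ≠ 0) (hz : z ≠ 0) (m : ℕ) :
    ∏ j ∈ Finset.range (2 * m), (1 + z * q ^ (1 - 2 * (m : ℤ)) * (q ^ 2) ^ j)
      = z ^ m * q ^ (-((m : ℤ) ^ 2)) *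
        ∏ j ∈ Finset.range m, ((1 + z * q ^ (2 * j + 1)) * (1 + z⁻¹ * q ^ (2 * j + 1))) := by
  induction m with
  | zero => simp
  | succ m ih =>
    have shift (j : ℕ) : z * q ^ (1 - 2 * ((m + 1 : ℕ) : ℤ)) * (q ^ 2) ^ (j + 1)
        = z * q ^ (1 - 2 * (m : ℤ)) * (q ^ 2) ^ j := by
      rw [show 1 - 2 * (m : ℤ) = 1 - 2 * ((m + 1 : ℕ) : ℤ) + 2 by push_cast; ring,
        zpow_add₀ hq, zpow_ofNat]
      ring
    have last_factor : z * q ^ (1 - 2 * (m : ℤ)) * (q ^ 2) ^ (2 * m) = z * q ^ (2 * m + 1) := by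
      rw [← pow_mul, mul_assoc, ← zpow_natCast, ← zpow_natCast q (2 * m + 1), ← zpow_add₀ hq]
      congr 2
      push_cast
      ring
    have first_factor : q ^ (1 - 2 * ((m + 1 : ℕ) : ℤ)) = (q ^ (2 * m + 1))⁻¹ := by
      rw [← zpow_natCast, ← zpow_neg]
      congr 1
    have monomial : q ^ (-(((m + 1 : ℕ) : ℤ) ^ 2))
        = q ^ (-((m : ℤ) ^ 2)) * (q ^ (2 * m + 1))⁻¹ := by
      rw [← zpow_natCast, ← zpow_neg, ← zpow_add₀ hq]
      congr 1
      push_cast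
      ring
    rw [Nat.mul_succ, Finset.prod_range_succ', Finset.prod_range_succ]
    simp only [shift]
    rw [ih, Finset.prod_range_succ, last_factor, first_factor, monomial]
    simp only [pow_zero, mul_one, pow_succ z]
    have hpow : q ^ (2 * m + 1) ≠ 0 := pow_ne_zero _ hq
    generalize q ^ (2 * m + 1) = w at hpow
    field_simp
    ring

lemma two_mul_choose_two (i : ℕ) : 2 * (i.choose 2 : ℤ) = i * (i - 1) := by
  qify
  rw [Nat.cast_choose_two]
  ring

lemma prod_range_eq_sum_gaussBinom (hq : q ≠ 0) (hz : z ≠ 0) (m : ℕ) :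
    ∏ j ∈ Finset.range m, ((1 + z * q ^ (2 * j + 1)) * (1 + z⁻¹ * q ^ (2 * j + 1)))
      = ∑ i ∈ Finset.range (2 * m + 1), gaussBinom (q ^ 2) (2 * m) i *
          (z ^ ((i : ℤ) - m) * q ^ (((i : ℤ) - m) ^ 2)) := by
  have monomial_ne_zero : z ^ m * q ^ (-((m : ℤ) ^ 2)) ≠ 0 :=
    mul_ne_zero (pow_ne_zero _ hz) (zpow_ne_zero _ hq)
  apply mul_left_cancel₀ monomial_ne_zero
  rw [← prod_range_two_mul_one_add hq hz, prod_one_add_mul_pow_eq_sum_gaussBinom, Finset.mul_sum]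
  refine Finset.sum_congr rfl fun i _ => ?_
  have z_exponent : z ^ i = z ^ m * z ^ ((i : ℤ) - m) := by
    rw [← zpow_natCast, ← zpow_natCast, ← zpow_add₀ hz, add_sub_cancel]
  have q_exponent : (q ^ 2) ^ i.choose 2 * (q ^ (1 - 2 * (m : ℤ))) ^ i
      = q ^ (-((m : ℤ) ^ 2)) * q ^ (((i : ℤ) - m) ^ 2) := by
    rw [← pow_mul, ← zpow_natCast, ← zpow_natCast, ← zpow_mul, ← zpow_add₀ hq, ← zpow_add₀ hq]
    congr 1
    push_cast
    linear_combination two_mul_choose_two i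
  rw [mul_pow, z_exponent]
  linear_combination gaussBinom (q ^ 2) (2 * m) i * z ^ m * z ^ ((i : ℤ) - m) * q_exponent

/-- The coefficient of `z ^ n q ^ (n²)` in the finite triple product with `m` factors; it is the
Gaussian binomial `[2m, n + m]`, extended by zero to all integers `n`. -/
noncomputable def centralGaussBinom {R : Type*} [CommSemiring R] (q : R) (m : ℕ) (n : ℤ) : R :=
  if n ∈ Finset.Icc (-(m : ℤ)) m then gaussBinom q (2 * m) (n + m).toNat else 0

lemma prod_range_eq_tsum_centralGaussBinom [TopologicalSpace K] (hq : q ≠ 0)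
    (hz : z ≠ 0) (m : ℕ) :
    ∏ j ∈ Finset.range m, ((1 + z * q ^ (2 * j + 1)) * (1 + z⁻¹ * q ^ (2 * j + 1)))
      = ∑' n : ℤ, centralGaussBinom (q ^ 2) m n * (z ^ n * q ^ (n ^ 2)) := by
  rw [prod_range_eq_sum_gaussBinom hq hz, tsum_eq_sum (s := Finset.Icc (-(m : ℤ)) m)]
  · refine Finset.sum_nbij' (fun i => (i : ℤ) - m) (fun n => (n + m).toNat) ?_ ?_ ?_ ?_ ?_
      <;> simp only [Finset.mem_range, Finset.mem_Icc]
    · omega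
    · omega
    · simp
    · omega
    · intro i hi
      rw [centralGaussBinom, if_pos (by rw [Finset.mem_Icc]; omega)]
      simp
  · intro n hn
    rw [centralGaussBinom, if_neg hn, zero_mul]

end Field

end GaussBinom

/-! ### The Jacobi triple product -/

section TripleProduct

/-- Euler's function `(q; q)_∞ = ∏_{n ≥ 1} (1 - q ^ n)`. -/
noncomputable def eulerFun {𝕜 : Type*} [CommRing 𝕜] [TopologicalSpace 𝕜] (q : 𝕜) : 𝕜 :=
  ∏' n : ℕ, (1 - q ^ (n + 1))

/-- The theta series `∑_{n ∈ ℤ} z ^ n q ^ (n²)`. In Jacobi's notation `θ₃(q)`, `θ₄(q)` and `θ₂(q)`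
are its values at `z = 1`, at `z = -1` and, up to the factor `q ^ (1 / 4)`, at `z = q`. -/
noncomputable def thetaSeries {𝕜 : Type*} [Field 𝕜] [TopologicalSpace 𝕜] (q z : 𝕜) : 𝕜 :=
  ∑' n : ℤ, z ^ n * q ^ (n ^ 2)

variable {𝕜 : Type*} [NormedField 𝕜] {q z : 𝕜}

lemma norm_pow_lt_one (hq : ‖q‖ < 1) {n : ℕ} (hn : n ≠ 0) : ‖q ^ n‖ < 1 := by
  rw [norm_pow]
  exact pow_lt_one₀ (norm_nonneg q) hq hn

lemma one_sub_pow_succ_ne_zero (hq : ‖q‖ < 1) (n : ℕ) : 1 - q ^ (n + 1) ≠ 0 := fun h => by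
  have := norm_pow_lt_one hq n.succ_ne_zero
  rw [← sub_eq_zero.1 h, norm_one] at this
  exact this.false

lemma eulerProd_ne_zero (hq : ‖q‖ < 1) (m : ℕ) : eulerProd q m ≠ 0 :=
  Finset.prod_ne_zero_iff.2 fun n _ => one_sub_pow_succ_ne_zero hq n

lemma summable_norm_neg_pow_succ (hq : ‖q‖ < 1) : Summable fun n : ℕ => ‖-q ^ (n + 1)‖ := by
  simpa only [norm_neg, norm_pow] using
    (summable_nat_add_iff 1).2 (summable_geometric_of_lt_one (norm_nonneg q) hq)

lemma gaussBinom_eq_div (hq : ‖q‖ < 1) {N i : ℕ} (h : i ≤ N) :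
    gaussBinom q N i = eulerProd q N / (eulerProd q i * eulerProd q (N - i)) := by
  rw [eq_div_iff (mul_ne_zero (eulerProd_ne_zero hq _) (eulerProd_ne_zero hq _)),
    gaussBinom_mul_eulerProd_mul_eulerProd q h]

lemma summable_norm_pow_mul_pow_sq (hq : ‖q‖ < 1) (hq₀ : q ≠ 0) (hz : z ≠ 0) :
    Summable fun n : ℕ => ‖z ^ n * q ^ (n ^ 2)‖ := by
  have term_ne_zero (n : ℕ) : z ^ n * q ^ (n ^ 2) ≠ 0 :=
    mul_ne_zero (pow_ne_zero _ hz) (pow_ne_zero _ hq₀)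
  refine summable_of_ratio_test_tendsto_lt_one zero_lt_one
    (Eventually.of_forall fun n => norm_ne_zero_iff.2 (term_ne_zero n)) ?_
  have ratio (n : ℕ) : z ^ (n + 1) * q ^ ((n + 1) ^ 2) / (z ^ n * q ^ (n ^ 2))
      = z * q * (q ^ 2) ^ n := by
    rw [div_eq_iff (term_ne_zero n)]
    ring
  simp only [norm_norm, ← norm_div, ratio]
  simpa using ((tendsto_pow_atTop_nhds_zero_of_norm_lt_one
    (norm_pow_lt_one hq two_ne_zero)).const_mul (z * q)).norm

lemma summable_norm_thetaSeries (hq : ‖q‖ < 1) (hq₀ : q ≠ 0) (hz : z ≠ 0) :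
    Summable fun n : ℤ => ‖z ^ n * q ^ (n ^ 2)‖ := by
  refine Summable.of_nat_of_neg ?_ ?_
  · exact_mod_cast summable_norm_pow_mul_pow_sq hq hq₀ hz
  · have := summable_norm_pow_mul_pow_sq hq hq₀ (inv_ne_zero hz)
    simp only [inv_pow, zpow_neg, neg_sq] at this ⊢
    exact_mod_cast this

variable [CompleteSpace 𝕜]

lemma tendsto_eulerProd (hq : ‖q‖ < 1) : Tendsto (eulerProd q) atTop (𝓝 (eulerFun q)) := by
  have := multipliable_one_add_of_summable (f := fun n : ℕ => -q ^ (n + 1))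
    (summable_norm_neg_pow_succ hq)
  simp only [← sub_eq_add_neg] at this
  exact this.hasProd.tendsto_prod_nat

lemma eulerFun_ne_zero (hq : ‖q‖ < 1) : eulerFun q ≠ 0 := by
  have := tprod_one_add_ne_zero_of_summable (f := fun n : ℕ => -q ^ (n + 1))
    (by simpa only [← sub_eq_add_neg] using one_sub_pow_succ_ne_zero hq)
    (summable_norm_neg_pow_succ hq)
  simpa only [← sub_eq_add_neg, eulerFun] using this

lemma exists_norm_centralGaussBinom_le (hq : ‖q‖ < 1) :
    ∃ C, ∀ m n, ‖centralGaussBinom q m n‖ ≤ C := by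
  obtain ⟨A, hA⟩ := (Metric.isBounded_range_of_tendsto _ (tendsto_eulerProd hq)).exists_norm_le
  obtain ⟨B, hB⟩ := (Metric.isBounded_range_of_tendsto _
    ((tendsto_eulerProd hq).inv₀ (eulerFun_ne_zero hq))).exists_norm_le
  simp only [forall_mem_range] at hA hB
  have hA₀ : 0 ≤ A := (norm_nonneg _).trans (hA 0)
  have hB₀ : 0 ≤ B := (norm_nonneg _).trans (hB 0)
  refine ⟨A * (B * B), fun m n => ?_⟩
  rw [centralGaussBinom]
  split_ifs with hn
  · rw [Finset.mem_Icc] at hn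
    rw [gaussBinom_eq_div hq (by omega), div_eq_mul_inv, mul_inv, norm_mul, norm_mul]
    gcongr
    exacts [hA _, hB _, hB _]
  · rw [norm_zero]
    positivity

lemma tendsto_centralGaussBinom (hq : ‖q‖ < 1) (n : ℤ) :
    Tendsto (fun m => centralGaussBinom q m n) atTop (𝓝 (eulerFun q)⁻¹) := by
  have hE := tendsto_eulerProd hq
  have hE₀ := eulerFun_ne_zero hq
  have top_index : Tendsto (fun m : ℕ => 2 * m) atTop atTop := tendsto_id.const_mul_atTop' two_pos
  have bottom_index : Tendsto (fun m : ℕ => (n + m).toNat) atTop atTop :=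
    tendsto_atTop.2 fun b => by
      filter_upwards [eventually_ge_atTop (b + n.natAbs)] with m hm
      omega
  have index_sub : Tendsto (fun m : ℕ => 2 * m - (n + m).toNat) atTop atTop :=
    tendsto_atTop.2 fun b => by
      filter_upwards [eventually_ge_atTop (b + n.natAbs)] with m hm
      omega
  have := (hE.comp top_index).div ((hE.comp bottom_index).mul (hE.comp index_sub))
    (mul_ne_zero hE₀ hE₀)
  rw [div_mul_cancel_left₀ hE₀] at this
  refine this.congr' ?_
  filter_upwards [eventually_ge_atTop n.natAbs] with m hm
  rw [centralGaussBinom, if_pos (by rw [Finset.mem_Icc]; omega), gaussBinom_eq_div hq (by omega)]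
  rfl

/-- The **Jacobi triple product identity**. -/
theorem tendsto_triple_product (hq : ‖q‖ < 1) (hq₀ : q ≠ 0) (hz : z ≠ 0) :
    Tendsto (fun m => ∏ j ∈ Finset.range m,
        ((1 + z * q ^ (2 * j + 1)) * (1 + z⁻¹ * q ^ (2 * j + 1)))) atTop
      (𝓝 (thetaSeries q z / eulerFun (q ^ 2))) := by
  have hq2 : ‖q ^ 2‖ < 1 := norm_pow_lt_one hq two_ne_zero
  obtain ⟨C, hC⟩ := exists_norm_centralGaussBinom_le hq2
  have dominated := tendsto_tsum_of_dominated_convergence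
    ((summable_norm_thetaSeries hq hq₀ hz).mul_left C)
    (fun n : ℤ => (tendsto_centralGaussBinom hq2 n).mul_const (z ^ n * q ^ (n ^ 2)))
    (Eventually.of_forall fun m n => by
      rw [norm_mul]
      exact mul_le_mul_of_nonneg_right (hC m n) (norm_nonneg _))
  rw [tsum_mul_left, ← thetaSeries, ← div_eq_inv_mul] at dominated
  exact dominated.congr fun m => (prod_range_eq_tsum_centralGaussBinom hq₀ hz m).symm

end TripleProduct

/-! ### Theta constants as Euler products -/

section ThetaConstants

lemma prod_range_succ_one_add_inv_mul {K : Type*} [Field K] {q : K} (hq : q ≠ 0)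
    (m : ℕ) :
    ∏ j ∈ Finset.range (m + 1), (1 + q⁻¹ * q ^ (2 * j + 1))
      = 2 * ∏ j ∈ Finset.range m, (1 + q ^ (2 * j + 2)) := by
  have cancel (j : ℕ) : q⁻¹ * q ^ (2 * j + 1) = q ^ (2 * j) := by
    rw [pow_succ', inv_mul_cancel_left₀ hq]
  simp only [cancel, Finset.prod_range_succ', mul_zero, pow_zero, one_add_one_eq_two, mul_add,
    mul_one]
  rw [mul_comm]

variable {𝕜 : Type*} [NormedField 𝕜] [CompleteSpace 𝕜] {q : 𝕜}

lemma tendsto_prod_one_sub_odd (hq : ‖q‖ < 1) :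
    Tendsto (fun m => ∏ j ∈ Finset.range m, (1 - q ^ (2 * j + 1))) atTop
      (𝓝 (eulerFun q / eulerFun (q ^ 2))) := by
  have hq2 := norm_pow_lt_one hq two_ne_zero
  have two_mul_atTop : Tendsto (fun m : ℕ => 2 * m) atTop atTop :=
    tendsto_id.const_mul_atTop' two_pos
  refine (((tendsto_eulerProd hq).comp two_mul_atTop).div (tendsto_eulerProd hq2)
    (eulerFun_ne_zero hq2)).congr fun m => ?_
  rw [Pi.div_apply, Function.comp_apply, eulerProd_two_mul,
    mul_div_cancel_right₀ _ (eulerProd_ne_zero hq2 m)]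

lemma tendsto_prod_one_add_odd (hq : ‖q‖ < 1) :
    Tendsto (fun m => ∏ j ∈ Finset.range m, (1 + q ^ (2 * j + 1))) atTop
      (𝓝 (eulerFun (q ^ 2) / eulerFun (q ^ 4) / (eulerFun q / eulerFun (q ^ 2)))) := by
  have hq2 := norm_pow_lt_one hq two_ne_zero
  have quotient := (tendsto_prod_one_sub_odd hq2).div (tendsto_prod_one_sub_odd hq)
    (div_ne_zero (eulerFun_ne_zero hq) (eulerFun_ne_zero hq2))
  rw [← pow_mul] at quotient
  refine quotient.congr fun m => ?_
  rw [Pi.div_apply, ← Finset.prod_div_distrib]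
  refine Finset.prod_congr rfl fun j _ => ?_
  rw [div_eq_iff (one_sub_pow_succ_ne_zero hq (2 * j))]
  ring

lemma tendsto_prod_one_add_even (hq : ‖q‖ < 1) :
    Tendsto (fun m => ∏ j ∈ Finset.range m, (1 + q ^ (2 * j + 2))) atTop
      (𝓝 (eulerFun (q ^ 4) / eulerFun (q ^ 2))) := by
  have hq2 := norm_pow_lt_one hq two_ne_zero
  refine ((tendsto_eulerProd (norm_pow_lt_one hq four_ne_zero)).div (tendsto_eulerProd hq2)
    (eulerFun_ne_zero hq2)).congr fun m => ?_
  rw [Pi.div_apply, eulerProd, eulerProd, ← Finset.prod_div_distrib]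
  refine Finset.prod_congr rfl fun j _ => ?_
  rw [div_eq_iff (one_sub_pow_succ_ne_zero hq2 j)]
  ring

lemma thetaSeries_neg_one (hq : ‖q‖ < 1) (hq₀ : q ≠ 0) :
    thetaSeries q (-1) = eulerFun q ^ 2 / eulerFun (q ^ 2) := by
  have triple := tendsto_triple_product hq hq₀ (z := -1) (neg_ne_zero.2 one_ne_zero)
  simp only [inv_neg_one, neg_one_mul, ← sub_eq_add_neg, ← sq, Finset.prod_pow] at triple
  have h := tendsto_nhds_unique triple ((tendsto_prod_one_sub_odd hq).pow 2)
  have hφ2 := eulerFun_ne_zero (norm_pow_lt_one hq two_ne_zero)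
  field_simp at h ⊢
  linear_combination h

lemma thetaSeries_one (hq : ‖q‖ < 1) (hq₀ : q ≠ 0) :
    thetaSeries q 1 = eulerFun (q ^ 2) ^ 5 / (eulerFun q ^ 2 * eulerFun (q ^ 4) ^ 2) := by
  have triple := tendsto_triple_product hq hq₀ one_ne_zero
  simp only [inv_one, one_mul, ← sq, Finset.prod_pow] at triple
  have h := tendsto_nhds_unique triple ((tendsto_prod_one_add_odd hq).pow 2)
  have hφ := eulerFun_ne_zero hq
  have hφ2 := eulerFun_ne_zero (norm_pow_lt_one hq two_ne_zero)
  have hφ4 := eulerFun_ne_zero (norm_pow_lt_one hq four_ne_zero)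
  field_simp at h ⊢
  linear_combination h

lemma thetaSeries_self (hq : ‖q‖ < 1) (hq₀ : q ≠ 0) :
    thetaSeries q q = 2 * eulerFun (q ^ 4) ^ 2 / eulerFun (q ^ 2) := by
  have even := tendsto_prod_one_add_even hq
  have triple := (tendsto_add_atTop_iff_nat 1).2 (tendsto_triple_product hq hq₀ hq₀)
  simp only [Finset.prod_mul_distrib, prod_range_succ_one_add_inv_mul hq₀, ← pow_succ'] at triple
  have h := tendsto_nhds_unique triple
    (((tendsto_add_atTop_iff_nat 1).2 even).mul (even.const_mul 2))
  have hφ2 := eulerFun_ne_zero (norm_pow_lt_one hq two_ne_zero)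
  field_simp at h ⊢
  linear_combination h

lemma thetaSeries_one_mul_neg_one (hq : ‖q‖ < 1) (hq₀ : q ≠ 0) :
    thetaSeries q 1 * thetaSeries q (-1) = thetaSeries (q ^ 2) (-1) ^ 2 := by
  have hq2 := norm_pow_lt_one hq two_ne_zero
  rw [thetaSeries_one hq hq₀, thetaSeries_neg_one hq hq₀,
    thetaSeries_neg_one hq2 (pow_ne_zero 2 hq₀), ← pow_mul]
  have hφ := eulerFun_ne_zero hq
  have hφ2 := eulerFun_ne_zero hq2
  have hφ4 := eulerFun_ne_zero (norm_pow_lt_one hq four_ne_zero)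
  norm_num
  field_simp

lemma two_mul_thetaSeries_one_mul_self (hq : ‖q‖ < 1) (hq₀ : q ≠ 0) :
    2 * (thetaSeries (q ^ 2) 1 * thetaSeries (q ^ 2) (q ^ 2)) = thetaSeries q q ^ 2 := by
  have hq2 := norm_pow_lt_one hq two_ne_zero
  have hq2₀ := pow_ne_zero 2 hq₀
  rw [thetaSeries_one hq2 hq2₀, thetaSeries_self hq2 hq2₀, thetaSeries_self hq hq₀, ← pow_mul,
    ← pow_mul]
  have hφ2 := eulerFun_ne_zero hq2
  have hφ4 := eulerFun_ne_zero (norm_pow_lt_one hq four_ne_zero)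
  have hφ8 := eulerFun_ne_zero (norm_pow_lt_one hq (n := 8) (by norm_num))
  norm_num
  field_simp

end ThetaConstants

/-! ### Jacobi's quartic identity -/

section Quartic

/-- The two cosets of the index-two sublattice `{(m, n) | m ≡ n mod 2}` of `ℤ × ℤ`, each
parametrised by `ℤ × ℤ` through `(a, b) ↦ (a + b, a - b)`. -/
def parityEquiv : (ℤ × ℤ) ⊕ (ℤ × ℤ) ≃ ℤ × ℤ where
  toFun := Sum.elim (fun p => (p.1 + p.2, p.1 - p.2)) (fun p => (p.1 + p.2 + 1, p.1 - p.2))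
  invFun p := if (p.1 + p.2) % 2 = 0 then Sum.inl ((p.1 + p.2) / 2, (p.1 - p.2) / 2)
    else Sum.inr ((p.1 + p.2 - 1) / 2, (p.1 - p.2 - 1) / 2)
  left_inv := by rintro (⟨a, b⟩ | ⟨a, b⟩) <;> grind
  right_inv := by rintro ⟨m, n⟩; grind

lemma tsum_eq_tsum_parity {M : Type*} [AddCommGroup M] [UniformSpace M] [IsUniformAddGroup M]
    [CompleteSpace M] [T2Space M] {f : ℤ × ℤ → M} (hf : Summable f) :
    ∑' p, f p = ∑' p : ℤ × ℤ, f (p.1 + p.2, p.1 - p.2)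
      + ∑' p : ℤ × ℤ, f (p.1 + p.2 + 1, p.1 - p.2) := by
  have h := parityEquiv.summable_iff.2 hf
  rw [← parityEquiv.tsum_eq f]
  exact Summable.tsum_sum (h.comp_injective Sum.inl_injective) (h.comp_injective Sum.inr_injective)

variable {𝕜 : Type*} [NormedField 𝕜] [CompleteSpace 𝕜] {q z : 𝕜}

lemma hasSum_thetaSeries_sq (hq : ‖q‖ < 1) (hq₀ : q ≠ 0) (hz : z ≠ 0) :
    HasSum (fun p : ℤ × ℤ => z ^ (p.1 + p.2) * q ^ (p.1 ^ 2 + p.2 ^ 2)) (thetaSeries q z ^ 2) := by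
  have hs := summable_norm_thetaSeries hq hq₀ hz
  have := (summable_mul_of_summable_norm hs hs).hasSum
  rw [← tsum_mul_tsum_of_summable_norm hs hs] at this
  simpa only [zpow_add₀ hz, zpow_add₀ hq₀, mul_mul_mul_comm, thetaSeries, sq (∑' _, _)] using this

lemma thetaSeries_sq (hq : ‖q‖ < 1) (hq₀ : q ≠ 0) (hz : z ^ 2 = 1) :
    thetaSeries q z ^ 2 = thetaSeries (q ^ 2) 1 ^ 2 + z * q * thetaSeries (q ^ 2) (q ^ 2) ^ 2 := by
  have hz₀ : z ≠ 0 := by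
    rintro rfl
    simp at hz
  have hq2 := norm_pow_lt_one hq two_ne_zero
  have hq2₀ := pow_ne_zero 2 hq₀
  have z_even (n : ℤ) : z ^ (2 * n) = 1 := by rw [zpow_mul, zpow_ofNat, hz, one_zpow]
  have q_even (n : ℤ) : (q ^ 2) ^ n = q ^ (2 * n) := by rw [zpow_mul, zpow_ofNat]
  have hsum := hasSum_thetaSeries_sq hq hq₀ hz₀
  rw [← hsum.tsum_eq, ← (hasSum_thetaSeries_sq hq2 hq2₀ one_ne_zero).tsum_eq,
    ← (hasSum_thetaSeries_sq hq2 hq2₀ hq2₀).tsum_eq, tsum_eq_tsum_parity hsum.summable,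
    ← tsum_mul_left]
  congr 1 <;> refine tsum_congr fun ⟨a, b⟩ => ?_
  · rw [one_zpow, one_mul, q_even, show a + b + (a - b) = 2 * a by ring, z_even, one_mul]
    congr 1
    ring
  · rw [q_even, q_even, show a + b + 1 + (a - b) = 2 * a + 1 by ring, zpow_add₀ hz₀, z_even,
      one_mul, zpow_one, mul_assoc, ← zpow_add₀ hq₀, ← zpow_one_add₀ hq₀]
    congr 2
    ring

/-- **Jacobi's quartic identity** `θ₃⁴ - θ₄⁴ = θ₂⁴`. -/
theorem thetaSeries_one_pow_four_sub (hq : ‖q‖ < 1) (hq₀ : q ≠ 0) :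
    thetaSeries q 1 ^ 4 - thetaSeries q (-1) ^ 4 = q * thetaSeries q q ^ 4 := by
  have sq_one := thetaSeries_sq hq hq₀ (z := 1) (by norm_num)
  have sq_neg_one := thetaSeries_sq hq hq₀ (z := -1) (by norm_num)
  have pow_four (x : 𝕜) : x ^ 4 = (x ^ 2) ^ 2 := by ring
  rw [pow_four, pow_four (thetaSeries q (-1)), pow_four (thetaSeries q q), sq_one, sq_neg_one,
    ← two_mul_thetaSeries_one_mul_self hq hq₀]
  ring

end Quartic

/-! ### Theta constants and elliptic integrals -/

section Uniformization

lemma tendsto_thetaSeries_nhds_zero {𝕜 : Type*} [NormedField 𝕜] [CompleteSpace 𝕜] {z : 𝕜}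
    (hz : z ≠ 0) : Tendsto (fun q => thetaSeries q z) (𝓝 0) (𝓝 1) := by
  have sq_eq_natAbs (n : ℤ) : n ^ 2 = ((n.natAbs ^ 2 : ℕ) : ℤ) := by simp
  have bound_summable : Summable fun n : ℤ => ‖z‖ ^ n * (1 / 2 : ℝ) ^ (n ^ 2) :=
    (summable_norm_thetaSeries (by norm_num) (by norm_num) (norm_ne_zero_iff.2 hz)).of_norm
  have term_limit (n : ℤ) : Tendsto (fun q => z ^ n * q ^ (n ^ 2)) (𝓝 0)
      (𝓝 (if n = 0 then 1 else 0)) := by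
    simp only [sq_eq_natAbs, zpow_natCast]
    refine ((continuous_pow _).const_mul (z ^ n)).tendsto' 0 _ ?_
    split_ifs with hn
    · simp [hn]
    · rw [zero_pow (pow_ne_zero 2 (Int.natAbs_ne_zero.2 hn)), mul_zero]
  have dominated := tendsto_tsum_of_dominated_convergence bound_summable term_limit (by
    filter_upwards [Metric.closedBall_mem_nhds (0 : 𝕜) one_half_pos] with q hq n
    rw [mem_closedBall_zero_iff] at hq
    rw [norm_mul, norm_zpow, norm_zpow, sq_eq_natAbs, zpow_natCast, zpow_natCast]
    gcongr)
  rwa [tsum_ite_eq] at dominated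

lemma one_sub_pow_succ_pos {q : ℝ} (hq : ‖q‖ < 1) (n : ℕ) : 0 < 1 - q ^ (n + 1) :=
  sub_pos.2 ((le_norm_self _).trans_lt (norm_pow_lt_one hq n.succ_ne_zero))

lemma eulerFun_pos {q : ℝ} (hq : ‖q‖ < 1) : 0 < eulerFun q := by
  refine lt_of_le_of_ne' (ge_of_tendsto' (tendsto_eulerProd hq) fun m => ?_) (eulerFun_ne_zero hq)
  exact Finset.prod_nonneg fun n _ => (one_sub_pow_succ_pos hq n).le

/-- The elliptic parameter `k = 1 - θ₄⁴ / θ₃⁴` with nome `q`. -/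
noncomputable def ellipticParam (q : ℝ) : ℝ := 1 - thetaSeries q (-1) ^ 4 / thetaSeries q 1 ^ 4

lemma one_sub_ellipticParam (q : ℝ) :
    1 - ellipticParam q = thetaSeries q (-1) ^ 4 / thetaSeries q 1 ^ 4 :=
  sub_sub_cancel _ _

lemma norm_lt_one_of_mem_Ioo {q : ℝ} (hq : q ∈ Ioo (0 : ℝ) 1) : ‖q‖ < 1 := by
  rw [norm_of_nonneg hq.1.le]
  exact hq.2

lemma pow_mem_Ioo_zero_one {q : ℝ} (hq : q ∈ Ioo (0 : ℝ) 1) {n : ℕ} (hn : n ≠ 0) :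
    q ^ n ∈ Ioo (0 : ℝ) 1 :=
  ⟨pow_pos hq.1 n, pow_lt_one₀ hq.1.le hq.2 hn⟩

variable {q r k : ℝ}

lemma thetaSeries_one_pos (hq : q ∈ Ioo (0 : ℝ) 1) : 0 < thetaSeries q 1 := by
  have hq' := norm_lt_one_of_mem_Ioo hq
  have hφ := eulerFun_pos hq'
  have hφ2 := eulerFun_pos (norm_pow_lt_one hq' two_ne_zero)
  have hφ4 := eulerFun_pos (norm_pow_lt_one hq' four_ne_zero)
  rw [thetaSeries_one hq' hq.1.ne']
  positivity

lemma thetaSeries_neg_one_pos (hq : q ∈ Ioo (0 : ℝ) 1) : 0 < thetaSeries q (-1) := by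
  have hq' := norm_lt_one_of_mem_Ioo hq
  have hφ := eulerFun_pos hq'
  have hφ2 := eulerFun_pos (norm_pow_lt_one hq' two_ne_zero)
  rw [thetaSeries_neg_one hq' hq.1.ne']
  positivity

lemma thetaSeries_self_pos (hq : q ∈ Ioo (0 : ℝ) 1) : 0 < thetaSeries q q := by
  have hq' := norm_lt_one_of_mem_Ioo hq
  have hφ2 := eulerFun_pos (norm_pow_lt_one hq' two_ne_zero)
  have hφ4 := eulerFun_pos (norm_pow_lt_one hq' four_ne_zero)
  rw [thetaSeries_self hq' hq.1.ne']
  positivity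

lemma ellipticParam_eq (hq : q ∈ Ioo (0 : ℝ) 1) :
    ellipticParam q = q * thetaSeries q q ^ 4 / thetaSeries q 1 ^ 4 := by
  rw [ellipticParam, ← thetaSeries_one_pow_four_sub (norm_lt_one_of_mem_Ioo hq) hq.1.ne', sub_div,
    div_self (pow_ne_zero 4 (thetaSeries_one_pos hq).ne')]

lemma ellipticParam_mem_Ioo (hq : q ∈ Ioo (0 : ℝ) 1) : ellipticParam q ∈ Ioo (0 : ℝ) 1 := by
  have hq₀ := hq.1
  have h_one := thetaSeries_one_pos hq
  have h_neg_one := thetaSeries_neg_one_pos hq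
  have h_self := thetaSeries_self_pos hq
  constructor
  · rw [ellipticParam_eq hq]
    positivity
  · rw [← sub_pos, one_sub_ellipticParam]
    positivity

/-- Squaring the nome performs one AGM step on `(θ₃², θ₄²)`. -/
lemma gaussIntegral_thetaSeries_sq (hq : q ∈ Ioo (0 : ℝ) 1) :
    gaussIntegral (thetaSeries (q ^ 2) 1 ^ 2) (thetaSeries (q ^ 2) (-1) ^ 2)
      = gaussIntegral (thetaSeries q 1 ^ 2) (thetaSeries q (-1) ^ 2) := by
  have hq' := norm_lt_one_of_mem_Ioo hq
  have arithmetic_mean :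
      thetaSeries (q ^ 2) 1 ^ 2 = (thetaSeries q 1 ^ 2 + thetaSeries q (-1) ^ 2) / 2 := by
    rw [thetaSeries_sq hq' hq.1.ne' (z := 1) (by norm_num),
      thetaSeries_sq hq' hq.1.ne' (z := -1) (by norm_num)]
    ring
  have geometric_mean :
      (thetaSeries (q ^ 2) (-1) ^ 2) ^ 2 = thetaSeries q 1 ^ 2 * thetaSeries q (-1) ^ 2 := by
    rw [← thetaSeries_one_mul_neg_one hq' hq.1.ne']
    ring
  rw [arithmetic_mean]
  exact gaussIntegral_add_div_two (pow_pos (thetaSeries_one_pos hq) 2)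
    (pow_pos (thetaSeries_neg_one_pos hq) 2)
    (pow_pos (thetaSeries_neg_one_pos (pow_mem_Ioo_zero_one hq two_ne_zero)) 2) geometric_mean

lemma gaussIntegral_thetaSeries_pow_two_pow (hq : q ∈ Ioo (0 : ℝ) 1) (n : ℕ) :
    gaussIntegral (thetaSeries (q ^ 2 ^ n) 1 ^ 2) (thetaSeries (q ^ 2 ^ n) (-1) ^ 2)
      = gaussIntegral (thetaSeries q 1 ^ 2) (thetaSeries q (-1) ^ 2) := by
  induction n with
  | zero => rw [pow_zero, pow_one]
  | succ n ih =>
    rw [← ih, ← gaussIntegral_thetaSeries_sq (pow_mem_Ioo_zero_one hq (pow_ne_zero n two_ne_zero)),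
      ← pow_mul, ← pow_succ]

lemma gaussIntegral_thetaSeries (hq : q ∈ Ioo (0 : ℝ) 1) :
    gaussIntegral (thetaSeries q 1 ^ 2) (thetaSeries q (-1) ^ 2) = π / 2 := by
  have nome_limit : Tendsto (fun n : ℕ => q ^ 2 ^ n) atTop (𝓝 0) :=
    (tendsto_pow_atTop_nhds_zero_of_lt_one hq.1.le hq.2).comp
      (tendsto_pow_atTop_atTop_of_one_lt one_lt_two)
  have theta_sq_limit {z : ℝ} (hz : z ≠ 0) :
      Tendsto (fun n : ℕ => thetaSeries (q ^ 2 ^ n) z ^ 2) atTop (𝓝 1) := by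
    simpa using ((tendsto_thetaSeries_nhds_zero hz).comp nome_limit).pow 2
  have := tendsto_gaussIntegral one_pos (theta_sq_limit one_ne_zero)
    (theta_sq_limit (neg_ne_zero.2 one_ne_zero))
  simp only [gaussIntegral_thetaSeries_pow_two_pow hq, div_one] at this
  exact tendsto_nhds_unique tendsto_const_nhds this

theorem ellipticK_ellipticParam (hq : q ∈ Ioo (0 : ℝ) 1) :
    ellipticK (ellipticParam q) = π / 2 * thetaSeries q 1 ^ 2 := by
  have := ellipticK_one_sub_sq_div_sq (pow_pos (thetaSeries_one_pos hq) 2)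
    (thetaSeries q (-1) ^ 2)
  rw [gaussIntegral_thetaSeries hq, ← pow_mul, ← pow_mul] at this
  rw [ellipticParam, this, mul_comm]

lemma exp_neg_pi_mul_mem_Ioo (hr : 0 < r) : exp (-π * r) ∈ Ioo (0 : ℝ) 1 :=
  ⟨exp_pos _, exp_lt_one_iff.2 (mul_neg_of_neg_of_pos (neg_lt_zero.2 pi_pos) hr)⟩

lemma exp_zpow (x : ℝ) (n : ℤ) : exp x ^ n = exp (n * x) := by
  rw [← rpow_intCast, ← exp_mul, mul_comm]

lemma thetaSeries_exp_one (a : ℝ) :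
    thetaSeries (exp (-π * a)) 1 = ∑' n : ℤ, exp (-π * a * (n : ℝ) ^ 2) := by
  refine tsum_congr fun n => ?_
  rw [one_zpow, one_mul, exp_zpow, mul_comm, Int.cast_pow]

lemma ofReal_thetaSeries_exp_neg_one (a : ℝ) :
    ((thetaSeries (exp (-π * a)) (-1) : ℝ) : ℂ)
      = ∑' n : ℤ, Complex.exp (-π * a * n ^ 2 + 2 * π * (Complex.I / 2) * n) := by
  rw [thetaSeries, Complex.ofReal_tsum]
  refine tsum_congr fun n => ?_
  rw [Complex.exp_add, show (2 * π * (Complex.I / 2) * n : ℂ) = n * (π * Complex.I) by ring,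
    Complex.exp_int_mul, Complex.exp_pi_mul_I, exp_zpow, mul_comm _ (-π * a)]
  push_cast
  ring

lemma ofReal_exp_mul_thetaSeries_exp_self (a : ℝ) :
    ((exp (-π * a / 4) * thetaSeries (exp (-π * a)) (exp (-π * a)) : ℝ) : ℂ)
      = ∑' n : ℤ, Complex.exp (-π * a * (n + Complex.I * (Complex.I / 2)) ^ 2) := by
  rw [thetaSeries, ← tsum_mul_left, Complex.ofReal_tsum, ← (Equiv.neg ℤ).tsum_eq]
  refine tsum_congr fun n => ?_
  rw [exp_zpow, exp_zpow, ← exp_add, ← exp_add, ← mul_div_assoc, Complex.I_mul_I, Equiv.neg_apply]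
  push_cast
  congr 1
  ring

lemma thetaSeries_exp_inv_one (hr : 0 < r) :
    thetaSeries (exp (-π * r⁻¹)) 1 = √r * thetaSeries (exp (-π * r)) 1 := by
  rw [thetaSeries_exp_one, thetaSeries_exp_one, Real.tsum_exp_neg_mul_int_sq hr, ← sqrt_eq_rpow,
    ← mul_assoc, mul_one_div_cancel (sqrt_pos.2 hr).ne', one_mul]
  simp only [div_eq_mul_inv]

lemma exp_mul_thetaSeries_exp_inv_self (hr : 0 < r) :
    exp (-π * r⁻¹ / 4) * thetaSeries (exp (-π * r⁻¹)) (exp (-π * r⁻¹))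
      = √r * thetaSeries (exp (-π * r)) (-1) := by
  have poisson := Complex.tsum_exp_neg_quadratic (a := (r : ℂ)) (by simpa using hr) (Complex.I / 2)
  have sqrt_cast : (r : ℂ) ^ (1 / 2 : ℂ) = (√r : ℂ) := by
    rw [sqrt_eq_rpow, Complex.ofReal_cpow hr.le]
    norm_num
  rw [← ofReal_thetaSeries_exp_neg_one, sqrt_cast, div_eq_mul_inv (-π : ℂ), ← Complex.ofReal_inv,
    ← ofReal_exp_mul_thetaSeries_exp_self] at poisson
  have hs : (√r : ℂ) ≠ 0 := Complex.ofReal_ne_zero.2 (sqrt_pos.2 hr).ne'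
  rw [eq_comm, ← Complex.ofReal_inj, Complex.ofReal_mul, poisson, ← mul_assoc,
    mul_one_div_cancel hs, one_mul]

lemma ellipticParam_exp_inv (hr : 0 < r) :
    ellipticParam (exp (-π * r⁻¹)) = 1 - ellipticParam (exp (-π * r)) := by
  have numerator : exp (-π * r⁻¹) * thetaSeries (exp (-π * r⁻¹)) (exp (-π * r⁻¹)) ^ 4
      = (√r * thetaSeries (exp (-π * r)) (-1)) ^ 4 := by
    rw [← exp_mul_thetaSeries_exp_inv_self hr, mul_pow, ← exp_nat_mul]
    congr 2
    push_cast
    ring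
  rw [ellipticParam_eq (exp_neg_pi_mul_mem_Ioo (inv_pos.2 hr)), one_sub_ellipticParam,
    thetaSeries_exp_inv_one hr, numerator, mul_pow, mul_pow,
    mul_div_mul_left _ _ (pow_pos (sqrt_pos.2 hr) 4).ne']

theorem periodRatio_ellipticParam (hr : 0 < r) :
    periodRatio (ellipticParam (exp (-π * r))) = r := by
  have hq := exp_neg_pi_mul_mem_Ioo hr
  have hK := ellipticK_pos (ellipticParam_mem_Ioo hq).2
  rw [ellipticK_ellipticParam hq] at hK
  rw [periodRatio, ← ellipticParam_exp_inv hr, ellipticK_ellipticParam hq,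
    ellipticK_ellipticParam (exp_neg_pi_mul_mem_Ioo (inv_pos.2 hr)), thetaSeries_exp_inv_one hr,
    mul_pow, sq_sqrt hr.le, mul_left_comm, mul_div_cancel_right₀ _ hK.ne']

lemma periodRatio_pos (hk : k ∈ Ioo (0 : ℝ) 1) : 0 < periodRatio k :=
  div_pos (ellipticK_pos (Set.Ioo.one_sub_mem hk).2) (ellipticK_pos hk.2)

lemma ellipticParam_periodRatio (hk : k ∈ Ioo (0 : ℝ) 1) :
    ellipticParam (exp (-π * periodRatio k)) = k :=
  strictAntiOn_periodRatio.injOn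
    (ellipticParam_mem_Ioo (exp_neg_pi_mul_mem_Ioo (periodRatio_pos hk))) hk
    (periodRatio_ellipticParam (periodRatio_pos hk))

theorem existsUnique_periodRatio_eq (hr : 0 < r) : ∃! k, k ∈ Ioo (0 : ℝ) 1 ∧ periodRatio k = r :=
  ⟨ellipticParam (exp (-π * r)),
    ⟨ellipticParam_mem_Ioo (exp_neg_pi_mul_mem_Ioo hr), periodRatio_ellipticParam hr⟩,
    fun _ ⟨hk, hkr⟩ => by rw [← hkr, ellipticParam_periodRatio hk]⟩

end Uniformization

/-! ### The logarithmic derivative of Euler's function -/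

section Lambert

lemma summable_lambert {𝕜 : Type*} [NontriviallyNormedField 𝕜] [CompleteSpace 𝕜] {q : 𝕜}
    (hq : ‖q‖ < 1) : Summable fun n : ℕ => ((n : 𝕜) + 1) * q ^ (n + 1) / (1 - q ^ (n + 1)) := by
  have := (summable_norm_pow_mul_geometric_div_one_sub 1 hq).comp_injective (add_left_injective 1)
  simpa only [Function.comp_def, pow_one, Nat.cast_add, Nat.cast_one] using this

variable {q k : ℝ}

lemma summable_log_one_sub_pow (hq : ‖q‖ < 1) : Summable fun n : ℕ => log (1 - q ^ (n + 1)) := by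
  simpa only [← sub_eq_add_neg] using
    Real.summable_log_one_add_of_summable (summable_norm_neg_pow_succ hq).of_norm

lemma log_eulerFun (hq : ‖q‖ < 1) : log (eulerFun q) = ∑' n : ℕ, log (1 - q ^ (n + 1)) := by
  rw [eulerFun, ← Real.rexp_tsum_eq_tprod (one_sub_pow_succ_pos hq) (summable_log_one_sub_pow hq),
    log_exp]

lemma norm_deriv_log_one_sub_pow_le {ρ y : ℝ} (hρ : ρ < 1) (hy : ‖y‖ ≤ ρ) (n : ℕ) :
    ‖-(((n : ℝ) + 1) * y ^ n) / (1 - y ^ (n + 1))‖ ≤ ((n : ℝ) + 1) * ρ ^ n / (1 - ρ) := by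
  have pow_le : y ^ (n + 1) ≤ ρ :=
    calc y ^ (n + 1) ≤ ‖y‖ ^ (n + 1) := (le_norm_self _).trans_eq (norm_pow y _)
      _ ≤ ‖y‖ := pow_le_of_le_one (norm_nonneg y) (hy.trans hρ.le) n.succ_ne_zero
      _ ≤ ρ := hy
  have hρ₀ : 0 ≤ ρ := (norm_nonneg y).trans hy
  have : 0 < 1 - ρ := sub_pos.2 hρ
  rw [norm_div, norm_neg, norm_mul, norm_pow, norm_of_nonneg (r := (n : ℝ) + 1) (by positivity),
    norm_of_nonneg (one_sub_pow_succ_pos (hy.trans_lt hρ) n).le]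
  gcongr

lemma hasDerivAt_log_eulerFun (hq : ‖q‖ < 1) :
    HasDerivAt (fun q => log (eulerFun q))
      (∑' n : ℕ, -(((n : ℝ) + 1) * q ^ n) / (1 - q ^ (n + 1))) q := by
  obtain ⟨ρ, hqρ, hρ⟩ := exists_between hq
  have hρ₀ : 0 ≤ ρ := (norm_nonneg q).trans hqρ.le
  have bound_summable : Summable fun n : ℕ => ((n : ℝ) + 1) * ρ ^ n / (1 - ρ) := by
    have := (summable_pow_mul_geometric_of_norm_lt_one 1 (by rwa [norm_of_nonneg hρ₀])).add
      (summable_geometric_of_lt_one hρ₀ hρ)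
    exact (this.congr fun n => by ring).div_const _
  have term_deriv (n : ℕ) (y : ℝ) (hy : y ∈ Metric.ball 0 ρ) :
      HasDerivAt (fun y => log (1 - y ^ (n + 1)))
        (-(((n : ℝ) + 1) * y ^ n) / (1 - y ^ (n + 1))) y := by
    have : HasDerivAt (fun y : ℝ => 1 - y ^ (n + 1)) (-(((n : ℝ) + 1) * y ^ n)) y := by
      simpa using (hasDerivAt_pow (n + 1) y).const_sub 1
    exact this.log (one_sub_pow_succ_pos ((mem_ball_zero_iff.1 hy).trans hρ) n).ne'
  have hqball : q ∈ Metric.ball 0 ρ := mem_ball_zero_iff.2 hqρ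
  refine (hasDerivAt_tsum_of_isPreconnected bound_summable Metric.isOpen_ball
    (convex_ball 0 ρ).isPreconnected term_deriv
    (fun n y hy => norm_deriv_log_one_sub_pow_le hρ (mem_ball_zero_iff.1 hy).le n)
    hqball (summable_log_one_sub_pow hq) hqball).congr_of_eventuallyEq ?_
  filter_upwards [Metric.isOpen_ball.mem_nhds hqball] with y hy
  exact log_eulerFun ((mem_ball_zero_iff.1 hy).trans hρ)

lemma hasDerivAt_log_eulerFun_exp {x : ℝ} (hx : x < 0) :
    HasDerivAt (fun x => log (eulerFun (exp x)))
      (-∑' n : ℕ, ((n : ℝ) + 1) * exp x ^ (n + 1) / (1 - exp x ^ (n + 1))) x := by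
  have hq : ‖exp x‖ < 1 := norm_lt_one_of_mem_Ioo ⟨exp_pos x, exp_lt_one_iff.2 hx⟩
  refine ((hasDerivAt_log_eulerFun hq).comp x (hasDerivAt_exp x)).congr_deriv ?_
  rw [← tsum_mul_right, ← tsum_neg]
  exact tsum_congr fun n => by ring

theorem mul_eulerFun_pow (hq : q ∈ Ioo (0 : ℝ) 1) :
    q * eulerFun q ^ 24 = (2 / π * ellipticK (ellipticParam q)) ^ 12 * ellipticParam q
      * (1 - ellipticParam q) ^ 4 / 16 := by
  have hq' := norm_lt_one_of_mem_Ioo hq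
  have hq₀ := hq.1.ne'
  have hφ := eulerFun_ne_zero hq'
  have hφ2 := eulerFun_ne_zero (norm_pow_lt_one hq' two_ne_zero)
  have hφ4 := eulerFun_ne_zero (norm_pow_lt_one hq' four_ne_zero)
  have theta_sq : 2 / π * ellipticK (ellipticParam q) = thetaSeries q 1 ^ 2 := by
    rw [ellipticK_ellipticParam hq]
    field_simp
  rw [theta_sq, one_sub_ellipticParam, ellipticParam_eq hq, thetaSeries_one hq' hq₀,
    thetaSeries_neg_one hq' hq₀, thetaSeries_self hq' hq₀]
  field_simp
  norm_num

lemma log_discriminant (hk : k ∈ Ioo (0 : ℝ) 1) :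
    -π * periodRatio k + 24 * log (eulerFun (exp (-π * periodRatio k)))
      = 12 * log (ellipticK k) + log k + 4 * log (1 - k) + (12 * log (2 / π) - log 16) := by
  have hq := exp_neg_pi_mul_mem_Ioo (periodRatio_pos hk)
  have hφ := eulerFun_ne_zero (norm_lt_one_of_mem_Ioo hq)
  have hK := (ellipticK_pos hk.2).ne'
  have hk₀ := hk.1.ne'
  have hk₁ := (Set.Ioo.one_sub_mem hk).1.ne'
  have := congrArg log (mul_eulerFun_pow hq)
  rw [ellipticParam_periodRatio hk, mul_pow, log_mul (by positivity) (by positivity), log_exp,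
    log_div (by positivity) (by norm_num), log_mul (by positivity) (by positivity),
    log_mul (by positivity) (by positivity), log_mul (by positivity) (by positivity),
    log_pow, log_pow, log_pow, log_pow] at this
  push_cast at this
  linear_combination this

theorem tsum_lambert_eq (hk : k ∈ Ioo (0 : ℝ) 1) {q : ℝ} (hq : q = exp (-π * periodRatio k)) :
    24 * ∑' n : ℕ, ((n : ℝ) + 1) * q ^ (n + 1) / (1 - q ^ (n + 1))
      = 1 + (6 * ellipticE k + (k - 5) * ellipticK k) /
          (π * k * (1 - k) * ellipticK k * deriv periodRatio k) := by
  have hK := (ellipticK_pos hk.2).ne'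
  have hk₀ := hk.1.ne'
  have hk₁ := (Set.Ioo.one_sub_mem hk).1.ne'
  have hr := (deriv_periodRatio_neg hk).ne
  have log_nome : HasDerivAt (fun x => -π * periodRatio x) (-π * deriv periodRatio k) k :=
    (hasDerivAt_periodRatio hk).differentiableAt.hasDerivAt.const_mul _
  have deriv_left := log_nome.add (((hasDerivAt_log_eulerFun_exp
    (mul_neg_of_neg_of_pos (neg_lt_zero.2 pi_pos) (periodRatio_pos hk))).comp k log_nome).const_mul
      24)
  have deriv_right := (((((hasDerivAt_ellipticK hk.2 hk₀).log hK).const_mul 12).add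
    (hasDerivAt_log hk₀)).add ((((hasDerivAt_id k).const_sub 1).log hk₁).const_mul 4)).add_const
      (12 * log (2 / π) - log 16)
  have log_deriv := deriv_left.unique (deriv_right.congr_of_eventuallyEq (by
    filter_upwards [Ioo_mem_nhds hk.1 hk.2] with x hx
    exact log_discriminant hx))
  rw [← hq] at log_deriv
  generalize ∑' n : ℕ, ((n : ℝ) + 1) * q ^ (n + 1) / (1 - q ^ (n + 1)) = S at log_deriv ⊢
  simp only [id] at log_deriv
  field_simp at log_deriv ⊢
  linear_combination (1 / 2 : ℝ) * log_deriv

end Lambert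

theorem proposition8 (r : ℝ) (hr : 0 < r) :
    (∃! k : ℝ, k ∈ Set.Ioo (0 : ℝ) 1 ∧ periodRatio k = r) ∧
    ∀ k ∈ Set.Ioo (0 : ℝ) 1, periodRatio k = r →
      ∀ q : ℝ, q = Real.exp (-Real.pi * r) →
        HasDerivAt periodRatio (-Real.pi / (4 * k * (1 - k) * ellipticK k ^ 2)) k ∧
        deriv periodRatio k ≠ 0 ∧
        Summable (fun n : ℕ => ((n : ℝ) + 1) * q ^ (n + 1) / (1 - q ^ (n + 1))) ∧
        24 * ∑' n : ℕ, ((n : ℝ) + 1) * q ^ (n + 1) / (1 - q ^ (n + 1)) =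
          1 + (6 * ellipticE k + (k - 5) * ellipticK k) /
            (Real.pi * k * (1 - k) * ellipticK k * deriv periodRatio k) := by
  refine ⟨existsUnique_periodRatio_eq hr, fun k hk hkr q hq => ?_⟩
  have hq_mem : q ∈ Ioo (0 : ℝ) 1 := hq ▸ exp_neg_pi_mul_mem_Ioo hr
  exact ⟨hasDerivAt_periodRatio hk, (deriv_periodRatio_neg hk).ne,
    summable_lambert (norm_lt_one_of_mem_Ioo hq_mem), tsum_lambert_eq hk (hkr ▸ hq)⟩
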